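/- **Setting.** Let $\mathcal S,\mathcal A$ be finite, $H\in\mathbb N$, $\gamma\in[0,1)$, $K\in\mathbb N$, $p\in(0,1)$. In episode $k$ the agent faces the MDP with horizon $H$, discount $\gamma$, transition probabilities $P_{(k)}(\cdot\mid s,a)\in\Delta(\mathcal S)$ and rewards $R_{(k)}(s,a)\in\mathbb R$. Episode $k$ produces the states and actions $(s^{(k)}_h,a^{(k)}_h)$. At the end of episode $k$ a forecaster predicts, for episode $k+1$, rewards $\widetilde R_{(k+1)}(s,a)$ and transitions $\widehat P_{(k+1)}(s'\mid s,a)\ge 0$ with $\sum_{s'}\widehat P_{(k+1)}(s'\mid s,a)\le 1$. Put $$\Delta^r_k(s,a)=\big|R_{(k+1)}-\widetilde R_{(k+1)}\big|(s,a),\qquad \Delta^p_k(s,a)=\big\|(P_{(k+1)}-\widehat P_{(k+1)})(\cdot\mid s,a)\big\|_1,$$ $\tilde r_{\max}=\max_{1\le k\le K-1}\max_{s,a}|\widetilde R_{(k+1)}(s,a)|$, $r_{\max}=\max_{1\le k\le K-1}\max_{s,a}|R_{(k+1)}(s,a)|$. The exploration bonus is $$\Gamma_{(k)}(s,a)=\tfrac12\Delta^r_k(s,a)+\frac{\gamma\,\tilde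 r_{\max}}{2(1-\gamma)}\Delta^p_k(s,a),$$ and the forecast MDP for episode $k+1$ has transitions $\widehat P_{(k+1)}$ and rewards $\widehat R_{(k+1)}=\widetilde R_{(k+1)}+2\Gamma_{(k)}$. Let $\hat r_{\max}=\tilde r_{\max}+\max_{k,s,a}2\Gamma_{(k)}(s,a)$ (maximum over $1\le k\le K-1$) and $C_p=\frac{4\max(r_{\max},\hat r_{\max})}{1-\gamma}\sqrt{H\log(4/p)}$. For policies $\widehat\pi^{(k+1)}$, let $\widehat V^{(k+1)}_h,\widehat Q^{(k+1)}_h$ be the horizon-$H$ value functions of $\widehat\pi^{(k+1)}$ in the forecast MDP, and $\widehat V^{*,(k+1)}_\infty,\widehat Q^{*,(k+1)}_\infty$ its infinite-horizon discounted optimal value functions. Define $$\iota^{(k+1)}_h=R_{(k+1)}+\gamma P_{(k+1)}\widehat V^{(k+1)}_{h+1}-\widehat Q^{(k+1)}_h,\qquad \bar\iota^{(k+1)}_\infty=R_{(k+1)}+\gamma P_{(k+1)}\widehat V^{*,(k+1)}_\infty-\widehat Q^{*,(k+1)}_\infty,$$ $$\mathfrak R_I=\frac1{1-\gamma}\sum_{k=1}^{K-1}\max_{s,a}\bar\iota^{(k+1)}_\infty(s,a)-\sum_{k=1}^{K-1}\sum_{h=0}^{H-1}\iota^{(k+1)}_h\big(s^{(k+1)}_h,a^{(k+1)}_h\big)+C_p\sqrt{K-1},$$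 and let $\mathfrak R_I^{\rm abs}$ be the same expression with $\max_{s,a}|\bar\iota^{(k+1)}_\infty(s,a)|$ in place of $\max_{s,a}\bar\iota^{(k+1)}_\infty(s,a)$. **W-LSE.** Fix $\lambda\ge0$, window lengths $w_k\ge1$ (for instance $w_k=k$), a radius $B$, and noise variances $\sigma_r^2,\sigma_p^2\ge0$. Let $D_k(s,a)$ be the set of times $t=(k',h)$, $1\le k'\le k$, $0\le h<H$, with $(s^{(k')}_h,a^{(k')}_h)=(s,a)$. For a target $\square=R(s,a)$ (features: one-hot vectors indexed by $\mathcal S\times\mathcal A$, $x=(s,a)$, $\sigma=\sigma_r$) or $\square=P(s'\mid s,a)$ (one-hot vectors indexed by $\mathcal S\times\mathcal S\times\mathcal A$, $x=(s',s,a)$, $\sigma=\sigma_p$), with $\square_t=\square_{(k')}$ for $t=(k',h)$, W-LSE minimizes $$\mathcal L(\phi,q)=\sum_{t\in D_k(s,a)}q_t\,(\phi_x-\square_t)^2+\mathrm{disc}(q)+\frac{\lambda}{w_kH}\|\phi\|_2$$ jointly over parameter vectors $\phi$ with $\|\phi\|_2\le B$ and probability weights $q$ on $D_k(s,a)$, where,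 with $\eta\sim\mathcal N(0,\sigma^2)$, $$\mathrm{disc}(q)=\sup_{\|c\|_2\le B}\Big(\mathbb E_\eta\big[(c_x-\square_{(k+1)}-\eta)^2\big]-\sum_{t\in D_k(s,a)}q_t\,\mathbb E_\eta\big[(c_x-\square_t-\eta)^2\big]\Big).$$ The forecast is a W-LSE forecast if, for all $1\le k\le K-1$ and all $(s,a)$ with $D_k(s,a)\neq\emptyset$, $\widetilde R_{(k+1)}(s,a)$ and every $\widehat P_{(k+1)}(s'\mid s,a)$ equal $\phi_x$ for some joint minimizer $(\phi,q)$ of the corresponding problem. **Theorem.** For every W-LSE forecast, all policies $\widehat\pi^{(k+1)}$ and all trajectories, $$\mathfrak R_I\le\Big(4H+\frac{2\gamma|\mathcal S|}{1-\gamma}\Big(\frac1{1-\gamma}+H\Big)\Big)\Big(\frac12\sum_{k=1}^{K-1}\max_{s,a}\Delta^r_k(s,a)+\frac{\gamma\,\tilde r_{\max}}{2(1-\gamma)}\sum_{k=1}^{K-1}\max_{s,a}\Delta^p_k(s,a)\Big)+C_p\sqrt{K-1}.$$ The same bound holds for $\mathfrak R_I^{\rm abs}$ if $4H$ is replaced by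 $4\big(\frac1{1-\gamma}+H\big)$. Moreover, for all $1\le k\le K-1$ and all $(s,a)$ with $D_k(s,a)\ne\emptyset$, $$\Delta^r_k(s,a)\le\sqrt{\min_{\phi,q}\mathcal L^{R(s,a)}_k(\phi,q)},\qquad \Delta^p_k(s,a)\le\sum_{s'\in\mathcal S}\sqrt{\min_{\phi,q}\mathcal L^{P(s'\mid s,a)}_k(\phi,q)}.$$ -/

import Mathlib

open scoped NNReal

noncomputable section

namespace ProST

/-! ## Tabular discounted control: policies and value functions

A transition function is written `P s a s'` (probability of moving to `s'` from `s` under `a`),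
a reward function `R s a`, and a (randomized) policy `π s a`. -/

/-- `π s` is a probability vector over actions, for every state `s`. -/
def IsPolicy {S A : Type*} [Fintype A] (π : S → A → ℝ) : Prop :=
  ∀ s, π s ∈ stdSimplex ℝ A

/-- Expected discounted reward collected by `π` during `n` further steps, started in `s`
(backward Bellman recursion). -/
def valueToGo {S A : Type*} [Fintype S] [Fintype A] (γ : ℝ) (P : S → A → S → ℝ)
    (R : S → A → ℝ) (π : S → A → ℝ) : ℕ → S → ℝ
  | 0, _ => 0
  | n + 1, s => ∑ a, π s a * (R s a + γ * ∑ s', P s a s' * valueToGo γ P R π n s')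

/-- State value function of `π` at step `h` of the horizon-`H` problem; it vanishes at `h = H`. -/
def stepV {S A : Type*} [Fintype S] [Fintype A] (γ : ℝ) (P : S → A → S → ℝ) (R : S → A → ℝ)
    (π : S → A → ℝ) (H h : ℕ) (s : S) : ℝ :=
  valueToGo γ P R π (H - h) s

/-- State-action value function of `π` at step `h < H` of the horizon-`H` problem. -/
def stepQ {S A : Type*} [Fintype S] [Fintype A] (γ : ℝ) (P : S → A → S → ℝ) (R : S → A → ℝ)
    (π : S → A → ℝ) (H h : ℕ) (s : S) (a : A) : ℝ :=
  R s a + γ * ∑ s', P s a s' * stepV γ P R π H (h + 1) s'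

/-- One step of the state chain induced by `π`, acting on functions of the state. -/
def chainStep {S A : Type*} [Fintype S] [Fintype A] (P : S → A → S → ℝ) (π : S → A → ℝ)
    (v : S → ℝ) (s : S) : ℝ :=
  ∑ a, π s a * ∑ s', P s a s' * v s'

/-- Infinite-horizon discounted value of `π`: the sum over `n` of `γ ^ n` times the expected
reward at step `n`. -/
def infV {S A : Type*} [Fintype S] [Fintype A] (γ : ℝ) (P : S → A → S → ℝ) (R : S → A → ℝ)
    (π : S → A → ℝ) (s : S) : ℝ :=
  ∑' n : ℕ, γ ^ n * ((chainStep P π)^[n] (fun s => ∑ a, π s a * R s a)) s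

/-- Infinite-horizon optimal state value function. -/
def optV {S A : Type*} [Fintype S] [Fintype A] (γ : ℝ) (P : S → A → S → ℝ) (R : S → A → ℝ)
    (s : S) : ℝ :=
  ⨆ π : {π : S → A → ℝ // IsPolicy π}, infV γ P R π.1 s

/-- Infinite-horizon optimal state-action value function. -/
def optQ {S A : Type*} [Fintype S] [Fintype A] (γ : ℝ) (P : S → A → S → ℝ) (R : S → A → ℝ)
    (s : S) (a : A) : ℝ :=
  R s a + γ * ∑ s', P s a s' * optV γ P R s'

/-! ## The environment, the forecasts, and the data -/

/-- A non-stationary tabular environment: in episode `k` the agent faces the horizon-`H`,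
`γ`-discounted MDP with transition function `P k` and reward function `R k`. -/
structure Env (S A : Type*) [Fintype S] where
  H : ℕ
  γ : ℝ
  γ_nonneg : 0 ≤ γ
  γ_lt_one : γ < 1
  P : ℕ → S → A → S → ℝ
  P_mem : ∀ k s a, P k s a ∈ stdSimplex ℝ S
  R : ℕ → S → A → ℝ

/-- Forecast models: `R (k + 1)` and `P (k + 1)` are the reward function (before the bonus) and
the transition function that are predicted, at the end of episode `k`, for episode `k + 1`.
Rows of the forecast transition function are only required to have mass at most one, because
regularized least-squares estimates lose mass. -/
structure Forecast (S A : Type*) [Fintype S] where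
  P : ℕ → S → A → S → ℝ
  P_nonneg : ∀ k s a s', 0 ≤ P k s a s'
  P_sum_le : ∀ k s a, ∑ s', P k s a s' ≤ 1
  R : ℕ → S → A → ℝ

/-- The states `s k h` and actions `a k h` of episode `k` at step `h`. -/
structure Trajectories (S A : Type*) where
  s : ℕ → ℕ → S
  a : ℕ → ℕ → A

/-- Maximum over all state-action pairs. -/
def maxSA {S A : Type*} (f : S → A → ℝ) : ℝ := ⨆ x : S × A, f x.1 x.2

/-- Maximum over the episodes `1, …, K - 1` (zero if there are none). -/
def maxEp (K : ℕ) (u : ℕ → ℝ) : ℝ := ⨆ k : Finset.Icc 1 (K - 1), u k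

section Errors

variable {S A : Type*} [Fintype S]

/-- Reward forecasting error at the end of episode `k`. -/
def rewardError (M : Env S A) (F : Forecast S A) (k : ℕ) (s : S) (a : A) : ℝ :=
  |M.R (k + 1) s a - F.R (k + 1) s a|

/-- Transition forecasting error (in the `ℓ¹` norm) at the end of episode `k`. -/
def transError (M : Env S A) (F : Forecast S A) (k : ℕ) (s : S) (a : A) : ℝ :=
  ∑ s', |M.P (k + 1) s a s' - F.P (k + 1) s a s'|

/-- Largest absolute true reward over the episodes `2, …, K`. -/
def rMax (M : Env S A) (K : ℕ) : ℝ := maxEp K fun k => maxSA fun s a => |M.R (k + 1) s a|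

/-- Largest absolute forecast reward (before the bonus) over the episodes `2, …, K`. -/
def rTildeMax (F : Forecast S A) (K : ℕ) : ℝ :=
  maxEp K fun k => maxSA fun s a => |F.R (k + 1) s a|

/-- The exploration bonus of episode `k`. -/
def bonus (M : Env S A) (F : Forecast S A) (K k : ℕ) (s : S) (a : A) : ℝ :=
  1 / 2 * rewardError M F k s a
    + M.γ * rTildeMax F K / (2 * (1 - M.γ)) * transError M F k s a

/-- Reward function of the forecast MDP for episode `k + 1`, with the bonus included. -/
def bonusReward (M : Env S A) (F : Forecast S A) (K k : ℕ) (s : S) (a : A) : ℝ :=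
  F.R (k + 1) s a + 2 * bonus M F K k s a

/-- Bound for the rewards of the forecast MDPs: largest forecast reward plus largest bonus term. -/
def rHatMax (M : Env S A) (F : Forecast S A) (K : ℕ) : ℝ :=
  rTildeMax F K + maxEp K fun k => maxSA fun s a => 2 * bonus M F K k s a

/-- The constant multiplying `√(K - 1)` in the regret, at confidence level `p`. -/
def Cp (M : Env S A) (F : Forecast S A) (K : ℕ) (p : ℝ) : ℝ :=
  4 * max (rMax M K) (rHatMax M F K) / (1 - M.γ) * √((M.H : ℝ) * Real.log (4 / p))

variable [Fintype A]

/-- Model prediction error for episode `k + 1` at step `h`, for the policy `π` evaluated in the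
forecast MDP. -/
def predError (M : Env S A) (F : Forecast S A) (K : ℕ) (π : S → A → ℝ) (k h : ℕ)
    (s : S) (a : A) : ℝ :=
  M.R (k + 1) s a
    + M.γ * ∑ s', M.P (k + 1) s a s'
        * stepV M.γ (F.P (k + 1)) (bonusReward M F K k) π M.H (h + 1) s'
    - stepQ M.γ (F.P (k + 1)) (bonusReward M F K k) π M.H h s a

/-- Infinite-horizon model prediction error for episode `k + 1`, for the optimal value functions
of the forecast MDP. -/
def optPredError (M : Env S A) (F : Forecast S A) (K k : ℕ) (s : S) (a : A) : ℝ :=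
  M.R (k + 1) s a
    + M.γ * ∑ s', M.P (k + 1) s a s' * optV M.γ (F.P (k + 1)) (bonusReward M F K k) s'
    - optQ M.γ (F.P (k + 1)) (bonusReward M F K k) s a

/-- Model prediction errors summed along the trajectories of episodes `2, …, K`, where episode `k`
is played with the policy `π k`. -/
def trajPredError (M : Env S A) (F : Forecast S A) (K : ℕ) (π : ℕ → S → A → ℝ)
    (τ : Trajectories S A) : ℝ :=
  ∑ k ∈ Finset.Icc 1 (K - 1), ∑ h ∈ Finset.range M.H,
    predError M F K (π (k + 1)) k h (τ.s (k + 1) h) (τ.a (k + 1) h)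

/-- The part of the dynamic regret bound caused by the forecast, with the infinite-horizon error
measured by its maximum over state-action pairs. -/
def regretI (M : Env S A) (F : Forecast S A) (K : ℕ) (p : ℝ) (π : ℕ → S → A → ℝ)
    (τ : Trajectories S A) : ℝ :=
  (∑ k ∈ Finset.Icc 1 (K - 1), maxSA fun s a => optPredError M F K k s a) / (1 - M.γ)
    - trajPredError M F K π τ + Cp M F K p * √((K : ℝ) - 1)

/-- The same quantity with the infinite-horizon error measured by the maximum of its absolute
value. -/
def regretIAbs (M : Env S A) (F : Forecast S A) (K : ℕ) (p : ℝ) (π : ℕ → S → A → ℝ)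
    (τ : Trajectories S A) : ℝ :=
  (∑ k ∈ Finset.Icc 1 (K - 1), maxSA fun s a => |optPredError M F K k s a|) / (1 - M.γ)
    - trajPredError M F K π τ + Cp M F K p * √((K : ℝ) - 1)

end Errors

/-! ## Weighted regularized least squares with discrepancy

`X` indexes the coordinates of the one-hot features, so the linear predictor with parameter
`φ : EuclideanSpace ℝ X` takes the value `φ x` at `x`. For a fixed `x`, `D` is the finite set of
time stamps at which `x` was observed, `y t` is the mean of the observation at time `t`, `yNext`
that of the observation to be predicted, and observations carry independent centred Gaussian noise
of variance `v` (`v = 0` means exact observation). -/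

section WLSE

variable {X : Type*} [Fintype X]

/-- Conditional expectation, given the past, of the squared loss of the prediction `r` against a
noisy observation with mean `y`. -/
def expLoss (v : ℝ≥0) (r y : ℝ) : ℝ :=
  ∫ η, (r - (y + η)) ^ 2 ∂(ProbabilityTheory.gaussianReal 0 v)

/-- Discrepancy of the weights `q`: supremum, over the squared losses of the linear predictors with
parameter norm at most `B`, of the expected next loss minus the `q`-weighted past expected loss. -/
def disc (v : ℝ≥0) (B : ℝ) (x : X) (D : Finset (ℕ × ℕ)) (y : ℕ × ℕ → ℝ) (yNext : ℝ)
    (q : ℕ × ℕ → ℝ) : ℝ :=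
  ⨆ c : {c : EuclideanSpace ℝ X // ‖c‖ ≤ B},
    (expLoss v (c.1 x) yNext - ∑ t ∈ D, q t * expLoss v (c.1 x) (y t))

/-- The objective in the pair `z = (φ, q)` of parameter and data weights, with regularization
coefficient `reg`. -/
def objective (v : ℝ≥0) (B reg : ℝ) (x : X) (D : Finset (ℕ × ℕ)) (y : ℕ × ℕ → ℝ) (yNext : ℝ)
    (z : EuclideanSpace ℝ X × (ℕ × ℕ → ℝ)) : ℝ :=
  ∑ t ∈ D, z.2 t * (z.1 x - y t) ^ 2 + disc v B x D y yNext z.2 + reg * ‖z.1‖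

/-- Parameters of norm at most `B`, and probability weights supported on the data. -/
def feasible (B : ℝ) (D : Finset (ℕ × ℕ)) : Set (EuclideanSpace ℝ X × (ℕ × ℕ → ℝ)) :=
  {z | ‖z.1‖ ≤ B ∧ (∀ t, 0 ≤ z.2 t) ∧ (∀ t, t ∉ D → z.2 t = 0) ∧ ∑ t ∈ D, z.2 t = 1}

/-- `r` is the value predicted at `x` by a joint minimizer of the objective. -/
def IsWLSEValue (v : ℝ≥0) (B reg : ℝ) (x : X) (D : Finset (ℕ × ℕ)) (y : ℕ × ℕ → ℝ) (yNext : ℝ)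
    (r : ℝ) : Prop :=
  ∃ z ∈ feasible B D, IsMinOn (objective v B reg x D y yNext) (feasible B D) z ∧ r = z.1 x

/-- Optimal value of the joint minimization problem. -/
def wlseMin (v : ℝ≥0) (B reg : ℝ) (x : X) (D : Finset (ℕ × ℕ)) (y : ℕ × ℕ → ℝ) (yNext : ℝ) : ℝ :=
  sInf (objective v B reg x D y yNext '' feasible B D)

end WLSE

section Forecasting

variable {S A : Type*} [Fintype S] [Fintype A] [DecidableEq S] [DecidableEq A]

/-- The time stamps `(k', h)` up to the end of episode `k` at which `(s, a)` was visited. -/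
def visits (τ : Trajectories S A) (H k : ℕ) (s : S) (a : A) : Finset (ℕ × ℕ) :=
  (Finset.Icc 1 k ×ˢ Finset.range H).filter fun t => τ.s t.1 t.2 = s ∧ τ.a t.1 t.2 = a

/-- Parameters of the weighted least-squares problems: regularization `lam`, window `w k` in its
normalization, radius `B` of the predictor class, noise variances of the reward and transition
observations. -/
structure WLSEParams where
  lam : ℝ
  lam_nonneg : 0 ≤ lam
  w : ℕ → ℕ
  w_pos : ∀ k, 1 ≤ k → 0 < w k
  B : ℝ
  vr : ℝ≥0
  vp : ℝ≥0

/-- Regularization coefficient of the problem solved at the end of episode `k`. -/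
def WLSEParams.reg (Θ : WLSEParams) (H k : ℕ) : ℝ := Θ.lam / ((Θ.w k : ℝ) * H)

/-- `F` is a weighted least-squares forecast from the data `τ`: after each episode
`k = 1, …, K - 1` and at each pair `(s, a)` visited so far, the forecast reward and the forecast
transition probabilities come from joint minimizers. At unvisited pairs there are no data, and the
forecast is not constrained. -/
def IsWLSEForecast (M : Env S A) (τ : Trajectories S A) (K : ℕ) (Θ : WLSEParams)
    (F : Forecast S A) : Prop :=
  ∀ k ∈ Finset.Icc 1 (K - 1), ∀ (s : S) (a : A), (visits τ M.H k s a).Nonempty →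
    IsWLSEValue Θ.vr Θ.B (Θ.reg M.H k) (s, a) (visits τ M.H k s a)
        (fun t => M.R t.1 s a) (M.R (k + 1) s a) (F.R (k + 1) s a) ∧
    ∀ s' : S, IsWLSEValue Θ.vp Θ.B (Θ.reg M.H k) (s', s, a) (visits τ M.H k s a)
        (fun t => M.P t.1 s a s') (M.P (k + 1) s a s') (F.P (k + 1) s a s')

/-- Optimal value of the reward problem at `(s, a)` after episode `k`. -/
def rewardMin (M : Env S A) (τ : Trajectories S A) (Θ : WLSEParams) (k : ℕ) (s : S) (a : A) : ℝ :=
  wlseMin Θ.vr Θ.B (Θ.reg M.H k) (s, a) (visits τ M.H k s a)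
    (fun t => M.R t.1 s a) (M.R (k + 1) s a)

/-- Optimal value of the transition problem at `(s', s, a)` after episode `k`. -/
def transMin (M : Env S A) (τ : Trajectories S A) (Θ : WLSEParams) (k : ℕ) (s' s : S) (a : A) : ℝ :=
  wlseMin Θ.vp Θ.B (Θ.reg M.H k) (s', s, a) (visits τ M.H k s a)
    (fun t => M.P t.1 s a s') (M.P (k + 1) s a s')

end Forecasting

end ProST

end

/-! Both prediction errors have the form `R - R̃ - 2Γ + γ(P - P̂)V`, with one and the same forecast
value function `V` against both kernels, so no Bellman equation is needed, only a sup bound on `V`.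
Let `b` be `bonusBound`. Forecast rewards are at most `r̃max + 2b` in absolute value and rows of
`P̂` have mass at most one, so `|V| ≤ (r̃max + 2b)/(1 - γ)`. Hence `γ|(P - P̂)V|` is at most `γ
r̃max Δᵖ/(1 - γ) = 2Γ - Δʳ` plus a remainder `2γ|S|b/(1 - γ)` caused by the bonus inside `V`
(`discounted_model_error_le`). From above, the bonus cancels everything but the remainder
(`optPredError_le`); in absolute value a further `4Γ ≤ 4b` survives (`abs_predError_le`,
`abs_optPredError_le`). Summing over episodes, and over `H` steps along the trajectories, gives the
regret bounds; the `C_p` term is common to both sides. The least-squares bounds come from testing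
the supremum in the discrepancy with the fitted parameter itself: the weighted empirical loss
cancels and the squared forecast error remains below the objective (`sq_sub_le_objective`). -/

namespace ProST

/-! ### Maxima as real suprema over finite types -/

section Maxima

variable {S A : Type*}

lemma le_maxSA [Finite S] [Finite A] (f : S → A → ℝ) (s : S) (a : A) : f s a ≤ maxSA f :=
  le_ciSup (f := fun x : S × A => f x.1 x.2) (Set.finite_range _).bddAbove (s, a)

lemma maxSA_le [Nonempty S] [Nonempty A] {f : S → A → ℝ} {c : ℝ} (h : ∀ s a, f s a ≤ c) :
    maxSA f ≤ c :=
  ciSup_le fun x => h x.1 x.2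

lemma maxSA_nonneg {f : S → A → ℝ} (h : ∀ s a, 0 ≤ f s a) : 0 ≤ maxSA f :=
  Real.iSup_nonneg fun x => h x.1 x.2

lemma le_maxEp {K k : ℕ} (u : ℕ → ℝ) (hk : k ∈ Finset.Icc 1 (K - 1)) : u k ≤ maxEp K u :=
  le_ciSup (f := fun k : Finset.Icc 1 (K - 1) => u k) (Set.finite_range _).bddAbove ⟨k, hk⟩

lemma maxEp_nonneg (K : ℕ) {u : ℕ → ℝ} (h : ∀ k, 0 ≤ u k) : 0 ≤ maxEp K u :=
  Real.iSup_nonneg fun k => h k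

end Maxima

/-! ### Sup-norm bounds for values under substochastic kernels -/

section ValueBounds

variable {ι : Type*} [Fintype ι]

lemma abs_sum_mul_le (w v : ι → ℝ) {C : ℝ} (hv : ∀ i, |v i| ≤ C) :
    |∑ i, w i * v i| ≤ (∑ i, |w i|) * C := by
  rw [Finset.sum_mul]
  refine (Finset.abs_sum_le_sum_abs _ _).trans (Finset.sum_le_sum fun i _ => ?_)
  rw [abs_mul]
  exact mul_le_mul_of_nonneg_left (hv i) (abs_nonneg _)

/-- Mass below one only shrinks the average, since `C` is nonnegative; this is what accommodates
forecast rows that lose mass. -/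
lemma abs_sum_mul_le_of_sum_le_one {w v : ι → ℝ} {C : ℝ} (hw : ∀ i, 0 ≤ w i)
    (hw1 : ∑ i, w i ≤ 1) (hC : 0 ≤ C) (hv : ∀ i, |v i| ≤ C) : |∑ i, w i * v i| ≤ C := by
  refine (abs_sum_mul_le w v hv).trans ?_
  simp only [abs_of_nonneg (hw _)]
  exact mul_le_of_le_one_left hC hw1

variable {S A : Type*} [Fintype S] [Fintype A] {γ : ℝ} {P : S → A → S → ℝ} {R : S → A → ℝ}
  {π : S → A → ℝ} {c : ℝ}

/-- The constant `C = c / (1 - γ)` solves `C = c + γ C`, so each Bellman step preserves the bound,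
whatever the horizon. -/
lemma abs_valueToGo_le (hγ0 : 0 ≤ γ) (hγ1 : γ < 1) (hP : ∀ s a s', 0 ≤ P s a s')
    (hP1 : ∀ s a, ∑ s', P s a s' ≤ 1) (hπ : IsPolicy π) (hc : 0 ≤ c) (hR : ∀ s a, |R s a| ≤ c)
    (n : ℕ) (s : S) : |valueToGo γ P R π n s| ≤ c / (1 - γ) := by
  have hγ : 0 < 1 - γ := sub_pos.2 hγ1
  have hC : 0 ≤ c / (1 - γ) := div_nonneg hc hγ.le
  induction n generalizing s with
  | zero => simpa [valueToGo] using hC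
  | succ n ih =>
    refine abs_sum_mul_le_of_sum_le_one (hπ s).1 (hπ s).2.le hC fun a => ?_
    calc _ ≤ |R s a| + |γ * ∑ s', P s a s' * valueToGo γ P R π n s'| := abs_add_le _ _
      _ ≤ c + γ * (c / (1 - γ)) := by
        rw [abs_mul, abs_of_nonneg hγ0]
        exact add_le_add (hR s a) (mul_le_mul_of_nonneg_left
          (abs_sum_mul_le_of_sum_le_one (hP s a) (hP1 s a) hC ih) hγ0)
      _ = c / (1 - γ) := by field_simp; ring

lemma abs_iterate_chainStep_le (hP : ∀ s a s', 0 ≤ P s a s') (hP1 : ∀ s a, ∑ s', P s a s' ≤ 1)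
    (hπ : IsPolicy π) (hc : 0 ≤ c) {v : S → ℝ} (hv : ∀ s, |v s| ≤ c) (n : ℕ) (s : S) :
    |((chainStep P π)^[n] v) s| ≤ c := by
  induction n generalizing s with
  | zero => exact hv s
  | succ n ih =>
    rw [Function.iterate_succ_apply']
    exact abs_sum_mul_le_of_sum_le_one (hπ s).1 (hπ s).2.le hc fun a =>
      abs_sum_mul_le_of_sum_le_one (hP s a) (hP1 s a) hc ih

lemma abs_infV_le (hγ0 : 0 ≤ γ) (hγ1 : γ < 1) (hP : ∀ s a s', 0 ≤ P s a s')
    (hP1 : ∀ s a, ∑ s', P s a s' ≤ 1) (hπ : IsPolicy π) (hc : 0 ≤ c) (hR : ∀ s a, |R s a| ≤ c)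
    (s : S) : |infV γ P R π s| ≤ c / (1 - γ) := by
  have hsum : HasSum (fun n : ℕ => γ ^ n * c) (c / (1 - γ)) := by
    rw [div_eq_inv_mul]
    exact (hasSum_geometric_of_lt_one hγ0 hγ1).mul_right c
  rw [← Real.norm_eq_abs]
  refine tsum_of_norm_bounded hsum fun n => ?_
  rw [Real.norm_eq_abs, abs_mul, abs_of_nonneg (pow_nonneg hγ0 n)]
  refine mul_le_mul_of_nonneg_left (abs_iterate_chainStep_le hP hP1 hπ hc (fun s => ?_) n s)
    (pow_nonneg hγ0 n)
  exact abs_sum_mul_le_of_sum_le_one (hπ s).1 (hπ s).2.le hc (hR s)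

lemma abs_optV_le (hγ0 : 0 ≤ γ) (hγ1 : γ < 1) (hP : ∀ s a s', 0 ≤ P s a s')
    (hP1 : ∀ s a, ∑ s', P s a s' ≤ 1) (hc : 0 ≤ c) (hR : ∀ s a, |R s a| ≤ c) (s : S) :
    |optV γ P R s| ≤ c / (1 - γ) := by
  have hb (π : {π : S → A → ℝ // IsPolicy π}) : |infV γ P R π.1 s| ≤ c / (1 - γ) :=
    abs_infV_le hγ0 hγ1 hP hP1 π.2 hc hR s
  have hC : 0 ≤ c / (1 - γ) := div_nonneg hc (sub_pos.2 hγ1).le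
  unfold optV
  -- If there is no policy, the real supremum takes its default value `0`.
  cases isEmpty_or_nonempty {π : S → A → ℝ // IsPolicy π} with
  | inl h => simpa [Real.iSup_of_isEmpty] using hC
  | inr h =>
    refine abs_le.2 ⟨?_, ciSup_le fun π => (abs_le.1 (hb π)).2⟩
    refine (abs_le.1 (hb h.some)).1.trans
      (le_ciSup (f := fun π : {π : S → A → ℝ // IsPolicy π} => infV γ P R π.1 s)
        ⟨c / (1 - γ), ?_⟩ h.some)
    rintro _ ⟨π, rfl⟩
    exact (abs_le.1 (hb π)).2

end ValueBounds

/-! ### Prediction errors in terms of the bonus -/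

section PredictionErrors

variable {S A : Type*} [Fintype S] (M : Env S A) (F : Forecast S A) (K : ℕ)

lemma rewardError_nonneg (k : ℕ) (s : S) (a : A) : 0 ≤ rewardError M F k s a := abs_nonneg _

lemma transError_nonneg (k : ℕ) (s : S) (a : A) : 0 ≤ transError M F k s a :=
  Finset.sum_nonneg fun _ _ => abs_nonneg _

/-- Entries of both rows lie in `[0, 1]`. This crude count is the source of the factor `|S|` in the
regret bound. -/
lemma transError_le_card (k : ℕ) (s : S) (a : A) :
    transError M F k s a ≤ Fintype.card S := by
  have h : ∀ s' ∈ Finset.univ, |M.P (k + 1) s a s' - F.P (k + 1) s a s'| ≤ 1 := by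
    intro s' hs'
    have h1 : M.P (k + 1) s a s' ≤ 1 := (M.P_mem (k + 1) s a).2 ▸
      Finset.single_le_sum (fun i _ => (M.P_mem (k + 1) s a).1 i) hs'
    have h2 : F.P (k + 1) s a s' ≤ 1 :=
      (Finset.single_le_sum (fun i _ => F.P_nonneg (k + 1) s a i) hs').trans
        (F.P_sum_le (k + 1) s a)
    have h3 := (M.P_mem (k + 1) s a).1 s'
    have h4 := F.P_nonneg (k + 1) s a s'
    exact abs_le.2 ⟨by linarith, by linarith⟩
  simpa [transError] using Finset.sum_le_sum h

lemma rTildeMax_nonneg : 0 ≤ rTildeMax F K :=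
  maxEp_nonneg K fun _ => maxSA_nonneg fun _ _ => abs_nonneg _

lemma bonusCoeff_nonneg : 0 ≤ M.γ * rTildeMax F K / (2 * (1 - M.γ)) := by
  have := sub_pos.2 M.γ_lt_one
  have := M.γ_nonneg
  have := rTildeMax_nonneg F K
  positivity

lemma bonus_nonneg (k : ℕ) (s : S) (a : A) : 0 ≤ bonus M F K k s a :=
  add_nonneg (mul_nonneg (by norm_num) (rewardError_nonneg M F k s a))
    (mul_nonneg (bonusCoeff_nonneg M F K) (transError_nonneg M F k s a))

/-- Upper bound for the bonus of episode `k` in terms of the largest forecasting errors. -/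
noncomputable def bonusBound (k : ℕ) : ℝ :=
  1 / 2 * maxSA (rewardError M F k)
    + M.γ * rTildeMax F K / (2 * (1 - M.γ)) * maxSA (transError M F k)

variable {K}

lemma abs_forecast_reward_le [Finite A] {k : ℕ} (hk : k ∈ Finset.Icc 1 (K - 1)) (s : S) (a : A) :
    |F.R (k + 1) s a| ≤ rTildeMax F K :=
  (le_maxSA (fun s a => |F.R (k + 1) s a|) s a).trans
    (le_maxEp (fun k => maxSA fun s a => |F.R (k + 1) s a|) hk)

variable (K)

lemma bonus_le_bonusBound [Finite A] (k : ℕ) (s : S) (a : A) :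
    bonus M F K k s a ≤ bonusBound M F K k :=
  add_le_add (mul_le_mul_of_nonneg_left (le_maxSA _ s a) (by norm_num))
    (mul_le_mul_of_nonneg_left (le_maxSA _ s a) (bonusCoeff_nonneg M F K))

lemma bonusBound_nonneg (k : ℕ) : 0 ≤ bonusBound M F K k :=
  add_nonneg (mul_nonneg (by norm_num) (maxSA_nonneg (rewardError_nonneg M F k)))
    (mul_nonneg (bonusCoeff_nonneg M F K) (maxSA_nonneg (transError_nonneg M F k)))

lemma sum_bonusBound : ∑ k ∈ Finset.Icc 1 (K - 1), bonusBound M F K k =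
    1 / 2 * ∑ k ∈ Finset.Icc 1 (K - 1), maxSA (rewardError M F k)
      + M.γ * rTildeMax F K / (2 * (1 - M.γ))
        * ∑ k ∈ Finset.Icc 1 (K - 1), maxSA (transError M F k) := by
  simp only [bonusBound, Finset.sum_add_distrib, Finset.mul_sum]

variable {K}

lemma abs_bonusReward_le [Finite A] {k : ℕ} (hk : k ∈ Finset.Icc 1 (K - 1)) (s : S) (a : A) :
    |bonusReward M F K k s a| ≤ rTildeMax F K + 2 * bonusBound M F K k := by
  refine (abs_add_le _ _).trans (add_le_add (abs_forecast_reward_le F hk s a) ?_)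
  rw [abs_of_nonneg (mul_nonneg two_pos.le (bonus_nonneg M F K k s a))]
  exact mul_le_mul_of_nonneg_left (bonus_le_bonusBound M F K k s a) two_pos.le

/-- The discounted model error on a function bounded like a forecast value function, up to twice
the bonus minus the reward error. -/
lemma discounted_model_error_le (k : ℕ) (s : S) (a : A) {V : S → ℝ}
    (hV : ∀ s', |V s'| ≤ (rTildeMax F K + 2 * bonusBound M F K k) / (1 - M.γ)) :
    |M.γ * ∑ s', M.P (k + 1) s a s' * V s' - M.γ * ∑ s', F.P (k + 1) s a s' * V s'| ≤
      2 * bonus M F K k s a - rewardError M F k s a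
        + 2 * M.γ * Fintype.card S / (1 - M.γ) * bonusBound M F K k := by
  have hγ : 0 < 1 - M.γ := sub_pos.2 M.γ_lt_one
  have hγ0 := M.γ_nonneg
  have hb := bonusBound_nonneg M F K k
  have h1 := abs_sum_mul_le (fun s' => M.P (k + 1) s a s' - F.P (k + 1) s a s') V hV
  rw [← mul_sub, ← Finset.sum_sub_distrib, abs_mul, abs_of_nonneg hγ0]
  simp only [← sub_mul]
  calc _ ≤ M.γ * (transError M F k s a *
          ((rTildeMax F K + 2 * bonusBound M F K k) / (1 - M.γ))) :=
        mul_le_mul_of_nonneg_left h1 hγ0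
    -- The bonus coefficient is chosen so that the `rTildeMax` part of the product is exactly twice
    -- the bonus minus the reward error.
    _ = 2 * bonus M F K k s a - rewardError M F k s a
        + 2 * M.γ * transError M F k s a / (1 - M.γ) * bonusBound M F K k := by
      unfold bonus
      field_simp
      ring
    _ ≤ _ := by
      have := transError_le_card M F k s a
      gcongr

lemma sum_maxSA_div_le [Nonempty S] [Nonempty A] {u : ℕ → S → A → ℝ} {b : ℕ → ℝ} {c : ℝ}
    (h : ∀ k ∈ Finset.Icc 1 (K - 1), ∀ s a, u k s a ≤ c * b k) :
    (∑ k ∈ Finset.Icc 1 (K - 1), maxSA (u k)) / (1 - M.γ) ≤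
      c * (1 / (1 - M.γ)) * ∑ k ∈ Finset.Icc 1 (K - 1), b k := by
  have hγ : 0 < 1 - M.γ := sub_pos.2 M.γ_lt_one
  calc _ ≤ (∑ k ∈ Finset.Icc 1 (K - 1), c * b k) / (1 - M.γ) :=
        div_le_div_of_nonneg_right (Finset.sum_le_sum fun k hk => maxSA_le (h k hk)) hγ.le
    _ = _ := by rw [← Finset.mul_sum]; ring

variable [Fintype A]

lemma abs_predError_le {π : S → A → ℝ} (hπ : IsPolicy π) {k : ℕ}
    (hk : k ∈ Finset.Icc 1 (K - 1)) (h : ℕ) (s : S) (a : A) :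
    |predError M F K π k h s a| ≤
      (4 + 2 * M.γ * Fintype.card S / (1 - M.γ)) * bonusBound M F K k := by
  have hm := discounted_model_error_le M F (K := K) k s a fun s' =>
    abs_valueToGo_le M.γ_nonneg M.γ_lt_one (F.P_nonneg (k + 1)) (F.P_sum_le (k + 1)) hπ
      (add_nonneg (rTildeMax_nonneg F K) (mul_nonneg two_pos.le (bonusBound_nonneg M F K k)))
      (abs_bonusReward_le M F hk) (M.H - (h + 1)) s'
  have hb := bonus_le_bonusBound M F K k s a
  have hb0 := bonus_nonneg M F K k s a
  have hr : |M.R (k + 1) s a - F.R (k + 1) s a| ≤ rewardError M F k s a := le_rfl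
  rw [abs_le] at hm hr ⊢
  simp only [predError, stepQ, stepV, bonusReward] at hm ⊢
  constructor <;> linarith [hm.1, hm.2, hr.1, hr.2]

lemma optPredError_decomposition {k : ℕ} (hk : k ∈ Finset.Icc 1 (K - 1)) (s : S) (a : A) :
    |optPredError M F K k s a - (M.R (k + 1) s a - F.R (k + 1) s a - 2 * bonus M F K k s a)| ≤
      2 * bonus M F K k s a - rewardError M F k s a
        + 2 * M.γ * Fintype.card S / (1 - M.γ) * bonusBound M F K k := by
  have hm := discounted_model_error_le M F (K := K) k s a fun s' =>
    abs_optV_le M.γ_nonneg M.γ_lt_one (F.P_nonneg (k + 1)) (F.P_sum_le (k + 1))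
      (add_nonneg (rTildeMax_nonneg F K) (mul_nonneg two_pos.le (bonusBound_nonneg M F K k)))
      (abs_bonusReward_le M F hk) s'
  convert hm using 2
  simp only [optPredError, optQ, bonusReward]
  ring

/-- Optimism: the subtracted bonus pays for the reward error and for the main part of the transition
error, so no multiple `4` of the bonus appears. -/
lemma optPredError_le {k : ℕ} (hk : k ∈ Finset.Icc 1 (K - 1)) (s : S) (a : A) :
    optPredError M F K k s a ≤
      2 * M.γ * Fintype.card S / (1 - M.γ) * bonusBound M F K k := by
  have hm := (abs_le.1 (optPredError_decomposition M F hk s a)).2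
  have hr : M.R (k + 1) s a - F.R (k + 1) s a ≤ rewardError M F k s a := le_abs_self _
  linarith

/-- From below the bonus counts twice, once as added reward and once as transition error; hence the
`4`. -/
lemma abs_optPredError_le {k : ℕ} (hk : k ∈ Finset.Icc 1 (K - 1)) (s : S) (a : A) :
    |optPredError M F K k s a| ≤
      (4 + 2 * M.γ * Fintype.card S / (1 - M.γ)) * bonusBound M F K k := by
  have hm := abs_le.1 (optPredError_decomposition M F hk s a)
  have hr : |M.R (k + 1) s a - F.R (k + 1) s a| ≤ rewardError M F k s a := le_rfl
  have hb := bonus_le_bonusBound M F K k s a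
  have hb0 := bonus_nonneg M F K k s a
  rw [abs_le] at hr ⊢
  constructor <;> linarith [hm.1, hm.2, hr.1, hr.2]

lemma neg_trajPredError_le {π : ℕ → S → A → ℝ} (hπ : ∀ k, IsPolicy (π k))
    (τ : Trajectories S A) :
    -trajPredError M F K π τ ≤ M.H * (4 + 2 * M.γ * Fintype.card S / (1 - M.γ))
      * ∑ k ∈ Finset.Icc 1 (K - 1), bonusBound M F K k := by
  rw [trajPredError, ← Finset.sum_neg_distrib, Finset.mul_sum]
  refine Finset.sum_le_sum fun k hk => ?_
  rw [← Finset.sum_neg_distrib, mul_assoc, ← nsmul_eq_mul]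
  refine (Finset.sum_le_card_nsmul _ _ _ fun h _ =>
    (neg_le_abs _).trans (abs_predError_le M F (hπ (k + 1)) hk h _ _)).trans_eq ?_
  rw [Finset.card_range]

end PredictionErrors

/-! ### Discrepancy controls the forecast error -/

section LeastSquares

open MeasureTheory ProbabilityTheory

lemma expLoss_eq (v : ℝ≥0) (r y : ℝ) : expLoss v r y = (r - y) ^ 2 + v := by
  have hL : MemLp id 2 (gaussianReal 0 v) := memLp_id_gaussianReal 2
  have h1 : Integrable (fun η : ℝ => η) (gaussianReal 0 v) := hL.integrable one_le_two
  have h2 : Integrable (fun η : ℝ => η ^ 2) (gaussianReal 0 v) := hL.integrable_sq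
  have hm : ∫ η, η ∂(gaussianReal 0 v) = 0 := integral_id_gaussianReal
  have hv : ∫ η, η ^ 2 ∂(gaussianReal 0 v) = v := by
    have h := variance_of_integral_eq_zero (μ := gaussianReal 0 v) (X := fun η : ℝ => η)
      aemeasurable_id hm
    rw [← h, variance_fun_id_gaussianReal]
  have he : ∀ η : ℝ, (r - (y + η)) ^ 2 = (r - y) ^ 2 - 2 * (r - y) * η + η ^ 2 := fun η => by ring
  simp only [expLoss, he]
  have h3 : Integrable (fun η : ℝ => (r - y) ^ 2 - 2 * (r - y) * η) (gaussianReal 0 v) :=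
    (integrable_const _).sub (h1.const_mul _)
  rw [integral_add h3 h2, integral_sub (integrable_const _) (h1.const_mul _), integral_const_mul, hm, hv]
  simp

variable {X : Type*} [Fintype X] {v : ℝ≥0} {B reg : ℝ} {x : X} {D : Finset (ℕ × ℕ)}
  {y : ℕ × ℕ → ℝ} {yNext : ℝ}

/-- Needed because an unbounded real supremum would default to `0`. Past losses are nonnegative, and
a coordinate is at most the norm, hence at most `B`. -/
lemma bddAbove_disc {q : ℕ × ℕ → ℝ} (hq : ∀ t, 0 ≤ q t) :
    BddAbove (Set.range fun c : {c : EuclideanSpace ℝ X // ‖c‖ ≤ B} =>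
      (expLoss v (c.1 x) yNext - ∑ t ∈ D, q t * expLoss v (c.1 x) (y t))) := by
  refine ⟨(B + |yNext|) ^ 2 + v, ?_⟩
  rintro _ ⟨⟨c, hc⟩, rfl⟩
  have h1 : 0 ≤ ∑ t ∈ D, q t * expLoss v (c x) (y t) :=
    Finset.sum_nonneg fun t _ => mul_nonneg (hq t) (by rw [expLoss_eq]; positivity)
  have h2 : |c x - yNext| ≤ B + |yNext| :=
    (abs_sub _ _).trans (add_le_add_left ((PiLp.norm_apply_le c x).trans hc) _)
  have h3 : (c x - yNext) ^ 2 ≤ (B + |yNext|) ^ 2 :=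
    sq_le_sq' (abs_le.1 h2).1 (abs_le.1 h2).2
  simp only [expLoss_eq v (c x) yNext]
  linarith

lemma sq_sub_le_objective (hreg : 0 ≤ reg) {z : EuclideanSpace ℝ X × (ℕ × ℕ → ℝ)}
    (hz : z ∈ feasible B D) : (z.1 x - yNext) ^ 2 ≤ objective v B reg x D y yNext z := by
  obtain ⟨hB, hq, -, hq1⟩ := hz
  have hd : expLoss v (z.1 x) yNext - ∑ t ∈ D, z.2 t * expLoss v (z.1 x) (y t) ≤
      disc v B x D y yNext z.2 := le_ciSup (bddAbove_disc hq) ⟨z.1, hB⟩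
  -- The weights sum to one, so the noise variance enters the next and the past loss equally and
  -- cancels.
  simp only [expLoss_eq, mul_add, Finset.sum_add_distrib, ← Finset.sum_mul, hq1] at hd
  have := mul_nonneg hreg (norm_nonneg z.1)
  unfold objective
  linarith

lemma IsWLSEValue.abs_sub_le {r : ℝ} (hreg : 0 ≤ reg)
    (h : IsWLSEValue v B reg x D y yNext r) :
    |yNext - r| ≤ √(wlseMin v B reg x D y yNext) := by
  obtain ⟨z, hz, hmin, rfl⟩ := h
  -- The minimum is attained at `z`, so the infimum is a genuine objective value.
  have hleast : IsLeast (objective v B reg x D y yNext '' feasible B D)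
      (objective v B reg x D y yNext z) :=
    ⟨⟨z, hz, rfl⟩, by rintro _ ⟨z', hz', rfl⟩; exact hmin hz'⟩
  rw [wlseMin, hleast.csInf_eq, abs_sub_comm]
  exact Real.abs_le_sqrt (sq_sub_le_objective hreg hz)

lemma WLSEParams.reg_nonneg (Θ : WLSEParams) (H k : ℕ) : 0 ≤ Θ.reg H k :=
  div_nonneg Θ.lam_nonneg (by positivity)

end LeastSquares

end ProST

theorem mainTheorem6 {S A : Type*} [Fintype S] [Fintype A] [DecidableEq S] [DecidableEq A]
    (M : ProST.Env S A) (K : ℕ) (p : ℝ) (hp0 : 0 < p) (hp1 : p < 1)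
    (τ : ProST.Trajectories S A)
    (π : ℕ → S → A → ℝ) (hπ : ∀ k, ProST.IsPolicy (π k))
    (Θ : ProST.WLSEParams) (F : ProST.Forecast S A)
    (hF : ProST.IsWLSEForecast M τ K Θ F) :
    (ProST.regretI M F K p π τ ≤
      (4 * (M.H : ℝ)
          + 2 * M.γ * (Fintype.card S : ℝ) / (1 - M.γ) * (1 / (1 - M.γ) + (M.H : ℝ)))
        * (1 / 2 * ∑ k ∈ Finset.Icc 1 (K - 1), ProST.maxSA (ProST.rewardError M F k)
          + M.γ * ProST.rTildeMax F K / (2 * (1 - M.γ))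
            * ∑ k ∈ Finset.Icc 1 (K - 1), ProST.maxSA (ProST.transError M F k))
        + ProST.Cp M F K p * √((K : ℝ) - 1)) ∧
    (ProST.regretIAbs M F K p π τ ≤
      (4 * (1 / (1 - M.γ) + (M.H : ℝ))
          + 2 * M.γ * (Fintype.card S : ℝ) / (1 - M.γ) * (1 / (1 - M.γ) + (M.H : ℝ)))
        * (1 / 2 * ∑ k ∈ Finset.Icc 1 (K - 1), ProST.maxSA (ProST.rewardError M F k)
          + M.γ * ProST.rTildeMax F K / (2 * (1 - M.γ))
            * ∑ k ∈ Finset.Icc 1 (K - 1), ProST.maxSA (ProST.transError M F k))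
        + ProST.Cp M F K p * √((K : ℝ) - 1)) ∧
    (∀ k ∈ Finset.Icc 1 (K - 1), ∀ (s : S) (a : A), (ProST.visits τ M.H k s a).Nonempty →
      ProST.rewardError M F k s a ≤ √(ProST.rewardMin M τ Θ k s a) ∧
      ProST.transError M F k s a ≤ ∑ s' : S, √(ProST.transMin M τ Θ k s' s a)) := by
  -- The trajectory itself supplies a state and an action.
  obtain ⟨hS, hA⟩ : Nonempty S ∧ Nonempty A := ⟨⟨τ.s 0 0⟩, ⟨τ.a 0 0⟩⟩
  have htraj := ProST.neg_trajPredError_le M F (K := K) hπ τ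
  rw [← ProST.sum_bonusBound]
  refine ⟨?_, ?_, fun k hk s a hne => ?_⟩
  · have hopt := ProST.sum_maxSA_div_le M (K := K) fun k hk => ProST.optPredError_le M F hk
    unfold ProST.regretI
    linarith
  · have hopt := ProST.sum_maxSA_div_le M (K := K) fun k hk => ProST.abs_optPredError_le M F hk
    unfold ProST.regretIAbs
    linarith
  · obtain ⟨hr, hp⟩ := hF k hk s a hne
    exact ⟨hr.abs_sub_le (Θ.reg_nonneg M.H k),
      Finset.sum_le_sum fun s' _ => (hp s').abs_sub_le (Θ.reg_nonneg M.H k)⟩
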